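/- Let $n\ge 0$, let $\lambda=(\lambda_1\ge\cdots\ge\lambda_n\ge 0)$ be a partition, let $\rho=(n-1,n-2,\dots,0)$, and let $z_1,\dots,z_n,t_1,\dots,t_n$ be elements of a commutative ring (for instance independent variables). Consider the rectangular grid with $n$ rows and $\lambda_1+n$ columns (no columns if $n=0$); the columns are labelled $\lambda_1+n-1,\dots,1,0$ from left to right, and the rows are labelled $n,n-1,\dots,1$ from top to bottom. A *state* of the Delta ensemble $\mathfrak S^\Delta_\lambda$ assigns a spin $+$ or $-$ to every edge of the grid (including the boundary edges) such that: * every left boundary edge has spin $-$, and every right and every bottom boundary edge has spin $+$; the top boundary edge of a column has spin $-$ if the label of the column is $\lambda_i+n-i$ for some $1\le i\le n$, and spin $+$ otherwise; * at every vertex the spins (left, top, right, bottom) of the four adjacent edges form one of the six configurations below, where a vertex in the row labelled $i$ has the indicated Boltzmann weight: $$\begin{array}{c|cccccc} (\text{left, top, right, bottom}) & (+,+,+,+) & (+,+,-,-) & (-,+,-,+) & (+,-,+,-) & (-,-,+,+) & (-,-,-,-)\\ \hline \text{weight} & z_i & z_i(t_i+1) & 1 & z_it_i & 1 & 1 \end{array}$$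 The Boltzmann weight of a state is the product of the weights of all vertices, and the partition function $Z(\mathfrak S^\Delta_\lambda)$ is the sum of the Boltzmann weights of all states. Then $$Z(\mathfrak S^\Delta_\lambda)(z_1,\dots,z_n;t_1,\dots,t_n)=\prod_{1\le i<j\le n}(t_jz_j+z_i)\; s_\lambda(z_1,\dots,z_n),$$ where $s_\lambda=\det\bigl(x_i^{\lambda_j+n-j}\bigr)_{i,j}\big/\det\bigl(x_i^{n-j}\bigr)_{i,j}\in\mathbb Z[x_1,\dots,x_n]$ is the Schur polynomial. -/

import Mathlib

/-! ### Schur polynomials -/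

section Schur

/-- The alternant `a_μ(x_1, …, x_n) = det (x_i ^ μ_j)`, with integer coefficients. -/
noncomputable def alternant {n : ℕ} (μ : Fin n → ℕ) : MvPolynomial (Fin n) ℤ :=
  Matrix.det (Matrix.of fun i j : Fin n => (MvPolynomial.X i : MvPolynomial (Fin n) ℤ) ^ μ j)

/-- The weight `ρ = (n - 1, n - 2, …, 0)`. -/
def rhoWeight (n : ℕ) (i : Fin n) : ℕ := n - 1 - (i : ℕ)

/-- A square matrix `(f_j (x_i))` of values of polynomials has determinant divisible by the
Vandermonde determinant of the points `x_i`. -/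
theorem vandermonde_dvd_det_eval {S : Type*} [CommRing S] {n : ℕ} (x : Fin n → S)
    (f : Fin n → Polynomial S) :
    (Matrix.vandermonde x).det ∣ Matrix.det (Matrix.of fun i j => (f j).eval (x i)) := by
  nontriviality S
  set P : Polynomial S := ∏ i, (Polynomial.X - Polynomial.C (x i)) with hP
  have hmonic : P.Monic := Polynomial.monic_prod_of_monic _ _ fun i _ => Polynomial.monic_X_sub_C _
  have hdeg : P.natDegree = n := by
    rw [hP, Polynomial.natDegree_prod_of_monic _ _ fun i _ => Polynomial.monic_X_sub_C _]
    simp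
  have hroot : ∀ i, P.eval (x i) = 0 := fun i => by
    rw [hP, Polynomial.eval_prod]
    exact Finset.prod_eq_zero (Finset.mem_univ i) (by simp)
  have key : (Matrix.of fun i j => (f j).eval (x i)) =
      Matrix.vandermonde x * Matrix.of fun (k j : Fin n) => ((f j) %ₘ P).coeff k := by
    ext i j
    have h1 : (f j).eval (x i) = ((f j) %ₘ P).eval (x i) := by
      conv_lhs => rw [← Polynomial.modByMonic_add_div (f j) P]
      simp [hroot]
    have h2 : ((f j) %ₘ P).degree < n := by
      have := Polynomial.degree_modByMonic_lt (f j) hmonic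
      rwa [Polynomial.degree_eq_natDegree hmonic.ne_zero, hdeg] at this
    have h3 : ((f j) %ₘ P).eval (x i) =
        ∑ k ∈ Finset.range n, ((f j) %ₘ P).coeff k * x i ^ k := by
      by_cases hz : (f j) %ₘ P = 0
      · simp [hz]
      · exact Polynomial.eval_eq_sum_range' ((Polynomial.natDegree_lt_iff_degree_lt hz).2 h2) _
    simp only [Matrix.of_apply, Matrix.mul_apply, Matrix.vandermonde_apply]
    rw [h1, h3, Finset.sum_range]
    exact Finset.sum_congr rfl fun k _ => mul_comm _ _
  rw [key, Matrix.det_mul]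
  exact dvd_mul_right _ _

theorem alternant_rho_eq (n : ℕ) :
    alternant (rhoWeight n) = ((Equiv.Perm.sign (Fin.revPerm : Equiv.Perm (Fin n)) : ℤ) :
      MvPolynomial (Fin n) ℤ) * (Matrix.vandermonde
        (fun i : Fin n => (MvPolynomial.X i : MvPolynomial (Fin n) ℤ))).det := by
  rw [← Matrix.det_permute']
  unfold alternant
  congr 1
  ext1 i j
  have h : n - ((j : ℕ) + 1) = rhoWeight n j := by unfold rhoWeight; omega
  simp [Matrix.submatrix_apply, Matrix.vandermonde_apply, h]

theorem alternant_rho_ne_zero (n : ℕ) : alternant (rhoWeight n) ≠ 0 := by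
  rw [alternant_rho_eq]
  refine mul_ne_zero ?_ (Matrix.det_vandermonde_ne_zero_iff.2 (MvPolynomial.X_injective))
  exact_mod_cast (Equiv.Perm.sign (Fin.revPerm : Equiv.Perm (Fin n))).ne_zero

theorem alternant_rho_dvd {n : ℕ} (μ : Fin n → ℕ) : alternant (rhoWeight n) ∣ alternant μ := by
  have h := vandermonde_dvd_det_eval
    (fun i : Fin n => (MvPolynomial.X i : MvPolynomial (Fin n) ℤ))
    (fun j => (Polynomial.X : Polynomial (MvPolynomial (Fin n) ℤ)) ^ μ j)
  simp only [Polynomial.eval_pow, Polynomial.eval_X] at h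
  rw [alternant_rho_eq]
  rcases Int.units_eq_one_or (Equiv.Perm.sign (Fin.revPerm : Equiv.Perm (Fin n))) with hs | hs <;>
    rw [hs] <;> simpa [alternant] using h

/-- The Schur polynomial `s_λ(x_1, …, x_n) = a_{λ + ρ} / a_ρ`, a polynomial with integer
coefficients: the quotient of the two alternants. -/
noncomputable def schurPolynomial {n : ℕ} (lam : Fin n → ℕ) : MvPolynomial (Fin n) ℤ :=
  Classical.choose (alternant_rho_dvd (lam + rhoWeight n))

/-- The defining property of the Schur polynomial. -/
theorem alternant_rho_mul_schurPolynomial {n : ℕ} (lam : Fin n → ℕ) :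
    alternant (rhoWeight n) * schurPolynomial lam = alternant (lam + rhoWeight n) :=
  (Classical.choose_spec (alternant_rho_dvd (lam + rhoWeight n))).symm

/-- The defining property determines the Schur polynomial. -/
theorem eq_schurPolynomial {n : ℕ} (lam : Fin n → ℕ) (p : MvPolynomial (Fin n) ℤ)
    (hp : alternant (rhoWeight n) * p = alternant (lam + rhoWeight n)) :
    p = schurPolynomial lam :=
  mul_left_cancel₀ (alternant_rho_ne_zero n)
    (hp.trans (alternant_rho_mul_schurPolynomial lam).symm)

end Schur

/-! ### Delta ice -/

/-- The spins `+` and `-`. -/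
inductive Spin : Type
  | plus : Spin
  | minus : Spin
  deriving DecidableEq

instance Spin.instFintype : Fintype Spin where
  elems := {Spin.plus, Spin.minus}
  complete := by intro s; cases s <;> simp

/-- The six admissible spin configurations around a vertex of Delta ice; the arguments are the
spins of the left, top, right and bottom edges. -/
def DeltaAdmissible : Spin → Spin → Spin → Spin → Prop
  | .plus, .plus, .plus, .plus => True
  | .plus, .plus, .minus, .minus => True
  | .minus, .plus, .minus, .plus => True
  | .plus, .minus, .plus, .minus => True
  | .minus, .minus, .plus, .plus => True
  | .minus, .minus, .minus, .minus => True
  | _, _, _, _ => False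

/-- The Boltzmann weight of a vertex of Delta ice with spectral parameter `z` and deformation
parameter `t`; the spins are those of the left, top, right and bottom edges. -/
def deltaWeight {R : Type*} [CommRing R] (z t : R) : Spin → Spin → Spin → Spin → R
  | .plus, .plus, .plus, .plus => z
  | .plus, .plus, .minus, .minus => z * (t + 1)
  | .minus, .plus, .minus, .plus => 1
  | .plus, .minus, .plus, .minus => z * t
  | .minus, .minus, .plus, .plus => 1
  | .minus, .minus, .minus, .minus => 1
  | _, _, _, _ => 0

/-- An assignment of spins to all edges of a grid with `n` rows and `N` columns: first the
vertical edges (in `n + 1` levels, from top to bottom), then the horizontal edges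
(`N + 1` in each row, from left to right).  The vertex in row `r` and column `c` (counted from
`0`, from the top and from the left) has left edge `x.2 r c.castSucc`, top edge
`x.1 r.castSucc c`, right edge `x.2 r c.succ` and bottom edge `x.1 r.succ c`. -/
abbrev IceConfiguration (n N : ℕ) : Type :=
  (Fin (n + 1) → Fin N → Spin) × (Fin n → Fin (N + 1) → Spin)

/-- The number `λ_1 + n` of columns of the grid (no columns if `n = 0`). -/
def numColumns {n : ℕ} (lam : Fin n → ℕ) : ℕ :=
  if h : 0 < n then lam ⟨0, h⟩ + n else 0

/-- The states of Delta ice with the boundary conditions determined by `λ`.  The columns are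
labelled `N - 1, …, 0` from left to right. -/
structure IsDeltaState {n : ℕ} (lam : Fin n → ℕ) (x : IceConfiguration n (numColumns lam)) :
    Prop where
  left : ∀ r, x.2 r 0 = Spin.minus
  right : ∀ r, x.2 r (Fin.last _) = Spin.plus
  bottom : ∀ c, x.1 (Fin.last n) c = Spin.plus
  top : ∀ c, x.1 0 c = Spin.minus ↔
    ∃ i : Fin n, lam i + rhoWeight n i = numColumns lam - 1 - (c : ℕ)
  admissible : ∀ r c, DeltaAdmissible (x.2 r c.castSucc) (x.1 r.castSucc c) (x.2 r c.succ)
    (x.1 r.succ c)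

/-- The Delta ensemble determined by `λ`. -/
noncomputable def deltaEnsemble {n : ℕ} (lam : Fin n → ℕ) :
    Finset (IceConfiguration n (numColumns lam)) :=
  open Classical in Finset.univ.filter (IsDeltaState lam)

/-- The Boltzmann weight of a state: the product of the weights of all vertices.  The rows are
labelled `n, …, 1` from top to bottom (so the top row has the last parameters), and the
vertices in the row labelled `i` have parameters `z_i, t_i`. -/
def deltaStateWeight {R : Type*} [CommRing R] {n N : ℕ} (z t : Fin n → R)
    (x : IceConfiguration n N) : R :=
  ∏ r : Fin n, ∏ c : Fin N, deltaWeight (z r.rev) (t r.rev) (x.2 r c.castSucc) (x.1 r.castSucc c)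
    (x.2 r c.succ) (x.1 r.succ c)

/-- The partition function of the Delta ensemble determined by `λ`. -/
noncomputable def deltaPartitionFunction {R : Type*} [CommRing R] {n : ℕ} (lam : Fin n → ℕ)
    (z t : Fin n → R) : R :=
  ∑ x ∈ deltaEnsemble lam, deltaStateWeight z t x

/-!
The rows of Delta ice are free fermionic, so a row acts on the exterior algebra in closed form.
Let `z, t` be the parameters of the top row, let `z_1, …, z_m` be those of the rows below, and put
`u_a = (z_1 ^ a, …, z_m ^ a)`, `x_a = u_{a+1} - z u_a` and `y_a = u_{a+1} + t z u_a`. Record a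
sequence of bottom spins of the top row by the exterior product of the vectors `x_b` over the
labels `b` of the columns with spin `-`. Summing over the fillings of the row then turns the top
spins, with labels `a_1 > ⋯ > a_k`, into the contraction of `y_{a_1} ∧ ⋯ ∧ y_{a_k}` with the
functional `y_a ↦ z ^ a`. This is `rowSum_eq`; it is proved column by column, together with a
companion formula for rows whose left spin is `+`, and uses only `v ∧ v = 0`.

Both families are rescalings of `u`: the coordinates of `x_a` are `(z_l - z) z_l ^ a`, those of
`y_a` are `(z_l + t z) z_l ^ a`. Hence in degree `m` the determinant takes the exterior product
of the `x_b` to `∏_l (z_l - z) det (z_l ^ b_j)`, and it takes the contraction to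
`∏_l (z_l + t z)` times the expansion of `det (z_l ^ a_j)` with the extra variable `z`
(`topCoeff_wedge_mul`, `topCoeff_contractWedge`). By induction on the number of rows,
`∏_{i < j} (z_i - z_j)` times the partition function is `∏_{i < j} (t_j z_j + z_i)` times the
alternant of the labels of the top spins `-` (`prod_sub_mul_latticeSum`). For the boundary
conditions of `λ` these labels are `λ + ρ`. The Vandermonde product is cancelled in the ring of
polynomials in independent variables, and the result is specialised.
-/

/-! ### The exterior algebra -/

section Exterior

variable {R M : Type*} [CommRing R] [AddCommGroup M] [Module R M]

/-- The exterior product `v_{a_1} ∧ v_{a_2} ∧ ⋯` of the members of a family of vectors that are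
listed in `l = [a_1, a_2, …]`. -/
noncomputable def wedge (v : ℕ → M) (l : List ℕ) : ExteriorAlgebra R M :=
  (l.map fun a => ExteriorAlgebra.ι R (v a)).prod

@[simp]
theorem wedge_nil (v : ℕ → M) : wedge (R := R) v [] = 1 := rfl

@[simp]
theorem wedge_cons (v : ℕ → M) (a : ℕ) (l : List ℕ) :
    wedge (R := R) v (a :: l) = ExteriorAlgebra.ι R (v a) * wedge v l := by
  simp [wedge]

theorem wedge_ofFn (v : ℕ → M) {k : ℕ} (a : Fin k → ℕ) :
    wedge (R := R) v (List.ofFn a) = ExteriorAlgebra.ιMulti R k fun i => v (a i) := by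
  simp [wedge, ExteriorAlgebra.ιMulti_apply, List.map_ofFn, Function.comp_def]

/-- The contraction of `y_{a_1} ∧ ⋯ ∧ y_{a_k}` with the functional `y_a ↦ z ^ a`, with the signs
of the expansion of a determinant along its last column. -/
noncomputable def contractWedge (z : R) (y : ℕ → M) : List ℕ → ExteriorAlgebra R M
  | [] => 0
  | a :: l => ((-1) ^ l.length * z ^ a) • wedge y l +
      ExteriorAlgebra.ι R (y a) * contractWedge z y l

theorem contractWedge_ofFn (z : R) (y : ℕ → M) {k : ℕ} (a : Fin (k + 1) → ℕ) :
    contractWedge z y (List.ofFn a) = ∑ i : Fin (k + 1), ((-1) ^ ((i : ℕ) + k) * z ^ a i) •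
      ExteriorAlgebra.ιMulti R k fun j => y (a (i.succAbove j)) := by
  induction k with
  | zero => simp [contractWedge]
  | succ k ih =>
    rw [List.ofFn_succ, contractWedge, ih, wedge_ofFn, Finset.mul_sum]
    conv_rhs => rw [Fin.sum_univ_succ]
    simp only [List.length_ofFn, Fin.val_zero, zero_add, Fin.succAbove_zero, add_right_inj]
    refine Finset.sum_congr rfl fun i _ => ?_
    rw [ExteriorAlgebra.ιMulti_succ_apply, mul_smul_comm]
    have hs : (-1 : R) ^ ((i : ℕ) + k) = (-1) ^ (((i.succ : Fin (k + 2)) : ℕ) + (k + 1)) := by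
      rw [Fin.val_succ, show (i : ℕ) + 1 + (k + 1) = i + k + 2 by ring, pow_add _ _ 2]
      simp
    rw [hs]
    simp [Matrix.vecTail, Function.comp_def]

/-- The linear functional on the exterior algebra of `R^m` that is the determinant in degree `m`
and zero in all other degrees. -/
noncomputable def topCoeff (R : Type*) [CommRing R] (m : ℕ) :
    ExteriorAlgebra R (Fin m → R) →ₗ[R] R :=
  ExteriorAlgebra.liftAlternating
    (Pi.single m Matrix.detRowAlternating : ∀ i, (Fin m → R) [⋀^Fin i]→ₗ[R] R)

theorem topCoeff_ιMulti {m : ℕ} (A : Fin m → Fin m → R) :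
    topCoeff R m (ExteriorAlgebra.ιMulti R m A) = Matrix.det (Matrix.of A) := by
  rw [topCoeff, ExteriorAlgebra.liftAlternating_apply_ιMulti, Pi.single_eq_same]
  rfl

theorem topCoeff_ιMulti_of_ne {m k : ℕ} (h : k ≠ m) (A : Fin k → Fin m → R) :
    topCoeff R m (ExteriorAlgebra.ιMulti R k A) = 0 := by
  rw [topCoeff, ExteriorAlgebra.liftAlternating_apply_ιMulti, Pi.single_eq_of_ne h]
  rfl

/-- The functional `topCoeff` on exterior products of rescaled vectors. -/
theorem topCoeff_wedge_mul {m : ℕ} (d : Fin m → R) (v : ℕ → Fin m → R) (l : List ℕ) :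
    topCoeff R m (wedge (fun a => d * v a) l) = (∏ i, d i) * topCoeff R m (wedge v l) := by
  obtain ⟨k, a, rfl⟩ : ∃ (k : ℕ) (a : Fin k → ℕ), l = List.ofFn a :=
    ⟨_, l.get, (List.ofFn_get l).symm⟩
  rw [wedge_ofFn, wedge_ofFn]
  by_cases h : k = m
  · subst h
    rw [topCoeff_ιMulti, topCoeff_ιMulti, ← Matrix.det_mul_row]
    rfl
  · rw [topCoeff_ιMulti_of_ne h, topCoeff_ιMulti_of_ne h, mul_zero]

/-- Laplace expansion of `det (z_i ^ a_j)` along the column of the last variable, where the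
remaining vectors are rescaled by `d`. If `l` does not have `m + 1` entries, both sides are `0`. -/
theorem topCoeff_contractWedge {m : ℕ} (z : Fin (m + 1) → R) (d : Fin m → R) (l : List ℕ) :
    topCoeff R m (contractWedge (z (Fin.last m)) (fun a i => d i * z i.castSucc ^ a) l) =
      (∏ i, d i) * topCoeff R (m + 1) (wedge (fun a i => z i ^ a) l) := by
  obtain ⟨k, a, rfl⟩ : ∃ (k : ℕ) (a : Fin k → ℕ), l = List.ofFn a :=
    ⟨_, l.get, (List.ofFn_get l).symm⟩
  obtain _ | k := k
  · rw [wedge_ofFn, topCoeff_ιMulti_of_ne (by omega)]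
    simp [contractWedge]
  have hy (i : Fin (k + 1)) : topCoeff R m (ExteriorAlgebra.ιMulti R k
      fun j => (fun b i => d i * z i.castSucc ^ b : ℕ → Fin m → R) (a (i.succAbove j))) =
      (∏ i, d i) * topCoeff R m (ExteriorAlgebra.ιMulti R k
        fun j i' => z i'.castSucc ^ a (i.succAbove j)) := by
    have := topCoeff_wedge_mul d (fun b i => z i.castSucc ^ b) (List.ofFn (a ∘ i.succAbove))
    rwa [wedge_ofFn, wedge_ofFn] at this
  rw [contractWedge_ofFn, wedge_ofFn, map_sum]
  simp only [map_smul, smul_eq_mul, hy]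
  by_cases h : k = m
  · subst h
    rw [topCoeff_ιMulti, Matrix.det_succ_column _ (Fin.last k), Finset.mul_sum]
    refine Finset.sum_congr rfl fun i _ => ?_
    rw [topCoeff_ιMulti]
    simp only [Matrix.of_apply, Fin.val_last, Fin.succAbove_last]
    rw [mul_left_comm]
    rfl
  · rw [topCoeff_ιMulti_of_ne (by omega), mul_zero]
    refine Finset.sum_eq_zero fun i _ => ?_
    rw [topCoeff_ιMulti_of_ne h, mul_zero, mul_zero]

end Exterior

/-! ### The transfer operator of a row -/

section Row

variable {R M : Type*} [CommRing R] [AddCommGroup M] [Module R M]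

/-- The labels, in decreasing order, of the columns whose vertical edge has spin `-`; among `N`
columns, the column `c` has the label `N - 1 - c`. -/
def minusLabels : (N : ℕ) → (Fin N → Spin) → List ℕ
  | 0, _ => []
  | N + 1, τ =>
    if τ 0 = Spin.minus then N :: minusLabels N (Fin.tail τ) else minusLabels N (Fin.tail τ)

theorem mem_minusLabels {N : ℕ} {τ : Fin N → Spin} {b : ℕ} :
    b ∈ minusLabels N τ ↔ ∃ c : Fin N, τ c = Spin.minus ∧ b = N - 1 - c := by
  induction N with
  | zero => simp [minusLabels]
  | succ N ih =>
    have h : b ∈ minusLabels (N + 1) τ ↔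
        (τ 0 = Spin.minus ∧ b = N) ∨ b ∈ minusLabels N (Fin.tail τ) := by
      rw [minusLabels]
      split_ifs with h <;> simp [h]
    rw [h, ih, Fin.exists_fin_succ]
    simp [Fin.tail, Nat.sub_add_eq, Nat.sub_right_comm]

theorem sortedGT_minusLabels (N : ℕ) (τ : Fin N → Spin) : (minusLabels N τ).SortedGT := by
  induction N with
  | zero => exact List.Pairwise.nil.sortedGT
  | succ N ih =>
    rw [minusLabels]
    split_ifs with h
    · refine List.Pairwise.sortedGT (List.pairwise_cons.2 ⟨fun b hb => ?_, (ih _).pairwise⟩)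
      obtain ⟨c, -, rfl⟩ := mem_minusLabels.1 hb
      have := c.2
      omega
    · exact ih _

theorem minusLabels_eq_nil {N : ℕ} {τ : Fin N → Spin} :
    minusLabels N τ = [] ↔ τ = fun _ => Spin.plus := by
  have hs (s : Spin) : s ≠ Spin.minus ↔ s = Spin.plus := by cases s <;> simp
  simp only [List.eq_nil_iff_forall_not_mem, mem_minusLabels, funext_iff, ← hs]
  exact ⟨fun h c hc => h _ ⟨c, hc, rfl⟩, fun h b ⟨c, hc, _⟩ => h c hc⟩

/-- The Boltzmann weight of one row of Delta ice with horizontal spins `h`, top spins `τ` and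
bottom spins `β`. -/
def rowWeight (z t : R) {N : ℕ} (h : Fin (N + 1) → Spin) (τ β : Fin N → Spin) : R :=
  ∏ c, deltaWeight z t (h c.castSucc) (τ c) (h c.succ) (β c)

/-- The generating function of the fillings of one row of Delta ice with left spin `s`, right
spin `+` and top spins `τ`: the bottom spins are recorded by the exterior product of the vectors
`x_b` over the labels `b` of the bottom spins `-`. -/
noncomputable def rowSum (z t : R) (x : ℕ → M) (N : ℕ) (s : Spin) (τ : Fin N → Spin) :
    ExteriorAlgebra R M :=
  ∑ β : Fin N → Spin, ∑ h : Fin (N + 1) → Spin,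
    if h 0 = s ∧ h (Fin.last N) = Spin.plus then
      rowWeight z t h τ β • wedge x (minusLabels N β) else 0

theorem sum_spin {A : Type*} [AddCommMonoid A] (f : Spin → A) :
    ∑ s, f s = f Spin.plus + f Spin.minus :=
  Finset.sum_pair (by decide : Spin.plus ≠ Spin.minus)

theorem sum_fin_cons {α A : Type*} [Fintype α] [AddCommMonoid A] {n : ℕ}
    (f : (Fin (n + 1) → α) → A) :
    ∑ x, f x = ∑ a, ∑ y : Fin n → α, f (Fin.cons a y : Fin (n + 1) → α) := by
  rw [← (Fin.consEquiv fun _ => α).sum_comp, Fintype.sum_prod_type]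
  rfl

/-- Removal of the leftmost column. -/
theorem rowSum_succ (z t : R) (x : ℕ → M) (N : ℕ) (s : Spin) (τ : Fin (N + 1) → Spin) :
    rowSum z t x (N + 1) s τ = ∑ b, ∑ s', deltaWeight z t s (τ 0) s' b •
      ((if b = Spin.minus then ExteriorAlgebra.ι R (x N) else 1) *
        rowSum z t x N s' (Fin.tail τ)) := by
  rw [rowSum, sum_fin_cons]
  refine Finset.sum_congr rfl fun b _ => ?_
  simp only [rowSum, Finset.mul_sum, Finset.smul_sum]
  conv_rhs => rw [Finset.sum_comm]
  refine Finset.sum_congr rfl fun β _ => ?_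
  rw [sum_fin_cons]
  conv_lhs => rw [Finset.sum_comm]
  conv_rhs => rw [Finset.sum_comm]
  refine Finset.sum_congr rfl fun h _ => ?_
  have hw (s₀ : Spin) : rowWeight z t (Fin.cons s₀ h : Fin (N + 2) → Spin) τ
      (Fin.cons b β : Fin (N + 1) → Spin) =
      deltaWeight z t s₀ (τ 0) (h 0) b * rowWeight z t h (Fin.tail τ) β := by
    rw [rowWeight, Fin.prod_univ_succ]
    rfl
  have hl (s₀ : Spin) : (Fin.cons s₀ h : Fin (N + 2) → Spin) (Fin.last (N + 1)) =
      h (Fin.last N) := rfl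
  have hb : wedge (R := R) x (minusLabels (N + 1) (Fin.cons b β : Fin (N + 1) → Spin)) =
      (if b = Spin.minus then ExteriorAlgebra.ι R (x N) else 1) * wedge x (minusLabels N β) := by
    rw [minusLabels, Fin.cons_zero, Fin.tail_cons]
    split_ifs <;> simp
  simp only [hw, hl, hb, Fin.cons_zero, ite_and, Finset.sum_ite_eq',
    Finset.mem_univ, if_true, mul_ite, smul_ite, mul_zero, smul_zero, Finset.sum_ite_eq]
  split_ifs <;> simp [mul_smul]

/-- The row of Delta ice in terms of the vectors `u_a`: if the bottom spins are recorded by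
`x_a = u_{a+1} - z u_a`, then a row with left spin `-` contracts the exterior product of the
vectors `y_a = u_{a+1} + t z u_a` that belong to the top spins. -/
theorem rowSum_eq (z t : R) (u : ℕ → M) (N : ℕ) (τ : Fin N → Spin) :
    rowSum z t (fun a => u (a + 1) - z • u a) N Spin.minus τ =
      contractWedge z (fun a => u (a + 1) + (t * z) • u a) (minusLabels N τ) ∧
    rowSum z t (fun a => u (a + 1) - z • u a) N Spin.plus τ =
      ((-1) ^ (minusLabels N τ).length * z ^ N) •
          wedge (fun a => u (a + 1) + (t * z) • u a) (minusLabels N τ) +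
        ((1 + t) * z) • (ExteriorAlgebra.ι R (u N) *
          contractWedge z (fun a => u (a + 1) + (t * z) • u a) (minusLabels N τ)) := by
  induction N with
  | zero =>
    simp only [rowSum, Fintype.sum_unique, ← (Equiv.funUnique (Fin 1) Spin).symm.sum_comp,
      sum_spin]
    simp [minusLabels, contractWedge, rowWeight]
  | succ N ih =>
    obtain ⟨ihm, ihp⟩ := ih (Fin.tail τ)
    simp only [rowSum_succ, sum_spin, ihm, ihp]
    generalize hx : contractWedge z (fun a => u (a + 1) + (t * z) • u a)
      (minusLabels N (Fin.tail τ)) = C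
    generalize hw : wedge (R := R) (fun a => u (a + 1) + (t * z) • u a)
      (minusLabels N (Fin.tail τ)) = W
    generalize hk : (minusLabels N (Fin.tail τ)).length = k
    rcases hτ : τ 0 with _ | _
    · have hl : minusLabels (N + 1) τ = minusLabels N (Fin.tail τ) := by simp [minusLabels, hτ]
      simp only [hl, deltaWeight, hx, hw, hk]
      constructor
      · simp
      · simp [sub_mul, smul_add, smul_sub, smul_smul]
        module
    · have hl : minusLabels (N + 1) τ = N :: minusLabels N (Fin.tail τ) := by
        simp [minusLabels, hτ]
      simp only [hl, deltaWeight, contractWedge, wedge_cons, List.length_cons, hx, hw, hk]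
      -- Besides the linear relations between `x`, `y` and `u`, only `u_N ∧ u_N = 0` and
      -- `u_{N+1} ∧ u_{N+1} = 0` are needed.
      have h0 : ExteriorAlgebra.ι R (u N) * (ExteriorAlgebra.ι R (u N) * C) = 0 := by
        rw [← mul_assoc, ExteriorAlgebra.ι_sq_zero, zero_mul]
      have h1 : ExteriorAlgebra.ι R (u (N + 1)) * (ExteriorAlgebra.ι R (u (N + 1)) * C) = 0 := by
        rw [← mul_assoc, ExteriorAlgebra.ι_sq_zero, zero_mul]
      constructor
      · simp [sub_mul, add_mul, smul_smul]
        module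
      · simp [sub_mul, add_mul, mul_add, smul_add, smul_sub, smul_smul, h0, h1]
        module

end Row

/-! ### The partition function -/

section Partition

variable {R : Type*} [CommRing R]

/-- The partition function of Delta ice on a grid with `n` rows, `N` columns and arbitrary top
spins `τ`. Admissibility is not required, as other vertices have weight `0`. -/
noncomputable def latticeSum {n : ℕ} (z t : Fin n → R) (N : ℕ) (τ : Fin N → Spin) : R :=
  ∑ x : IceConfiguration n N,
    if x.1 0 = τ ∧ (∀ r, x.2 r 0 = Spin.minus) ∧ (∀ r, x.2 r (Fin.last _) = Spin.plus) ∧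
      x.1 (Fin.last n) = fun _ => Spin.plus then deltaStateWeight z t x else 0

/-- Removal of the top row. -/
theorem latticeSum_succ {n : ℕ} (z t : Fin (n + 1) → R) (N : ℕ) (τ : Fin N → Spin) :
    latticeSum z t N τ = ∑ β : Fin N → Spin, (∑ h : Fin (N + 1) → Spin,
      if h 0 = Spin.minus ∧ h (Fin.last N) = Spin.plus then
        rowWeight (z (Fin.last n)) (t (Fin.last n)) h τ β else 0) *
      latticeSum (fun i => z i.castSucc) (fun i => t i.castSucc) N β := by
  have hw (τ₀ : Fin N → Spin) (h : Fin (N + 1) → Spin) (v : Fin (n + 1) → Fin N → Spin)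
      (w : Fin n → Fin (N + 1) → Spin) :
      deltaStateWeight z t ((Fin.cons τ₀ v, Fin.cons h w) : IceConfiguration (n + 1) N) =
        rowWeight (z (Fin.last n)) (t (Fin.last n)) h τ₀ (v 0) *
        deltaStateWeight (fun i => z i.castSucc) (fun i => t i.castSucc)
          ((v, w) : IceConfiguration n N) := by
    rw [deltaStateWeight, Fin.prod_univ_succ]
    simp only [Fin.rev_zero, Fin.rev_succ]
    rfl
  have hl (τ₀ : Fin N → Spin) (v : Fin (n + 1) → Fin N → Spin) :
      (Fin.cons τ₀ v : Fin (n + 2) → Fin N → Spin) (Fin.last (n + 1)) = v (Fin.last n) := rfl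
  rw [latticeSum, Fintype.sum_prod_type, sum_fin_cons, Finset.sum_comm]
  simp only [sum_fin_cons (α := Fin (N + 1) → Spin), hw, hl, Fin.cons_zero, Fin.forall_fin_succ,
    Fin.cons_succ]
  simp only [latticeSum, Fintype.sum_prod_type, Finset.mul_sum, Finset.sum_mul]
  conv_rhs => rw [Finset.sum_comm]
  refine Finset.sum_congr rfl fun v _ => ?_
  -- The first level of vertical edges is `τ`, and `β` is the second one.
  rw [Finset.sum_eq_single τ (fun b _ hb => by simp [hb]) (by simp),
    Finset.sum_eq_single (v 0) (fun b _ hb => by simp [hb.symm]) (by simp), Finset.sum_comm]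
  refine Finset.sum_congr rfl fun w _ => Finset.sum_congr rfl fun h _ => ?_
  rw [ite_zero_mul_ite_zero]
  simp only [true_and]
  congr 1
  simp only [eq_iff_iff]
  tauto

theorem prod_prod_Ioi_castSucc {n : ℕ} (f : Fin (n + 1) → Fin (n + 1) → R) :
    ∏ i, ∏ j ∈ Finset.Ioi i, f i j = (∏ i : Fin n, f i.castSucc (Fin.last n)) *
      ∏ i : Fin n, ∏ j ∈ Finset.Ioi i, f i.castSucc j.castSucc := by
  have h {m : ℕ} (g : Fin m → Fin m → R) :
      ∏ i, ∏ j ∈ Finset.Ioi i, g i j = ∏ i, ∏ j, if i < j then g i j else 1 :=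
    Finset.prod_congr rfl fun i _ => by
      rw [← Finset.prod_filter]
      exact Finset.prod_congr (by ext; simp) fun _ _ => rfl
  rw [h, h, Fin.prod_univ_castSucc, ← Finset.prod_mul_distrib]
  simp only [Fin.prod_univ_castSucc]
  simp [Fin.castSucc_lt_last, (Fin.le_last _).not_gt, mul_comm]

/-- The product formula, cleared of denominators, for arbitrary top spins. Nothing is
assumed about the number of spins `-` in the top row: both sides vanish unless it is `n`. -/
theorem prod_sub_mul_latticeSum {n : ℕ} (z t : Fin n → R) (N : ℕ) (τ : Fin N → Spin) :
    (∏ i : Fin n, ∏ j ∈ Finset.Ioi i, (z i - z j)) * latticeSum z t N τ =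
      (∏ i : Fin n, ∏ j ∈ Finset.Ioi i, (t j * z j + z i)) *
        topCoeff R n (wedge (fun a i => z i ^ a) (minusLabels N τ)) := by
  induction n generalizing τ with
  | zero =>
    have h0 : topCoeff R 0 (wedge (fun a i => z i ^ a) (minusLabels N τ)) =
        if (fun _ => Spin.plus) = τ then 1 else 0 := by
      split_ifs with h
      · rw [minusLabels_eq_nil.2 h.symm, ← List.ofFn_zero (f := Fin.elim0), wedge_ofFn,
          topCoeff_ιMulti, Matrix.det_fin_zero]
      · rw [← List.ofFn_get (minusLabels N τ), wedge_ofFn]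
        exact topCoeff_ιMulti_of_ne
          (fun hk => h (minusLabels_eq_nil.1 (List.length_eq_zero_iff.1 hk)).symm) _
    have h1 (v : Fin N → Spin) (w : Fin 0 → Fin N → Spin) :
        (Fin.cons v w : Fin 1 → Fin N → Spin) (Fin.last 0) = v := rfl
    rw [h0, latticeSum, Fintype.sum_prod_type, sum_fin_cons]
    simp only [Fintype.sum_unique, deltaStateWeight, Fin.cons_zero, h1, IsEmpty.forall_iff,
      true_and, Finset.univ_eq_empty, Finset.prod_empty, ite_and, Finset.sum_ite_eq',
      Finset.mem_univ, if_true]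
    simp only [eq_comm]
  | succ n ih =>
    set u : ℕ → Fin n → R := fun a i => z i.castSucc ^ a with hu
    have hx : (fun a => u (a + 1) - z (Fin.last n) • u a) =
        fun a => (fun i => z i.castSucc - z (Fin.last n)) * u a := by
      ext a i
      simp only [hu, Pi.sub_apply, Pi.smul_apply, Pi.mul_apply, smul_eq_mul]
      ring
    have hy : (fun a => u (a + 1) + (t (Fin.last n) * z (Fin.last n)) • u a) =
        fun a i => (t (Fin.last n) * z (Fin.last n) + z i.castSucc) * z i.castSucc ^ a := by
      ext a i
      simp only [hu, Pi.add_apply, Pi.smul_apply, smul_eq_mul]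
      ring
    have hrow := congrArg (topCoeff R n)
      (rowSum_eq (z (Fin.last n)) (t (Fin.last n)) u N τ).1
    rw [hy, topCoeff_contractWedge z, hx, rowSum, map_sum] at hrow
    rw [prod_prod_Ioi_castSucc, prod_prod_Ioi_castSucc, mul_right_comm _ _ (topCoeff _ _ _),
      ← hrow, latticeSum_succ, Finset.mul_sum, Finset.sum_mul]
    refine Finset.sum_congr rfl fun β _ => ?_
    rw [mul_mul_mul_comm, mul_comm (∏ i : Fin n, _) (Finset.sum _ _), mul_assoc (Finset.sum _ _),
      ih, map_sum, Finset.sum_mul, Finset.sum_mul]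
    refine Finset.sum_congr rfl fun h _ => ?_
    split_ifs with hc
    · rw [map_smul, topCoeff_wedge_mul, smul_eq_mul]
      ring
    · simp

end Partition

/-! ### The Delta ensemble and Schur polynomials -/

section Ensemble

variable {R : Type*} [CommRing R]

theorem deltaWeight_eq_zero (z t : R) {a b c d : Spin} (h : ¬DeltaAdmissible a b c d) :
    deltaWeight z t a b c d = 0 := by
  cases a <;> cases b <;> cases c <;> cases d <;> simp_all [DeltaAdmissible, deltaWeight]

theorem map_deltaWeight {S : Type*} [CommRing S] (f : R →+* S) (z t : R) (a b c d : Spin) :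
    f (deltaWeight z t a b c d) = deltaWeight (f z) (f t) a b c d := by
  cases a <;> cases b <;> cases c <;> cases d <;> simp [deltaWeight]

theorem map_deltaPartitionFunction {S : Type*} [CommRing S] (f : R →+* S) {n : ℕ}
    (lam : Fin n → ℕ) (z t : Fin n → R) :
    f (deltaPartitionFunction lam z t) = deltaPartitionFunction lam (f ∘ z) (f ∘ t) := by
  simp [deltaPartitionFunction, deltaStateWeight, map_deltaWeight]

/-- The top spins of the Delta ensemble determined by `λ`. -/
noncomputable def deltaTop {n : ℕ} (lam : Fin n → ℕ) (c : Fin (numColumns lam)) : Spin :=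
  open Classical in
  if ∃ i : Fin n, lam i + rhoWeight n i = numColumns lam - 1 - (c : ℕ) then Spin.minus
  else Spin.plus

theorem deltaTop_eq_minus {n : ℕ} (lam : Fin n → ℕ) (c : Fin (numColumns lam)) :
    deltaTop lam c = Spin.minus ↔
      ∃ i : Fin n, lam i + rhoWeight n i = numColumns lam - 1 - (c : ℕ) := by
  simp [deltaTop]

theorem deltaPartitionFunction_eq_latticeSum {n : ℕ} (lam : Fin n → ℕ) (z t : Fin n → R) :
    deltaPartitionFunction lam z t = latticeSum z t (numColumns lam) (deltaTop lam) := by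
  classical
  have hspin (a b : Spin) : a = b ↔ (a = Spin.minus ↔ b = Spin.minus) := by
    cases a <;> cases b <;> simp
  rw [deltaPartitionFunction, deltaEnsemble, Finset.sum_filter, latticeSum]
  refine Finset.sum_congr rfl fun x _ => ?_
  have htop : x.1 0 = deltaTop lam ↔ ∀ c, x.1 0 c = Spin.minus ↔
      ∃ i : Fin n, lam i + rhoWeight n i = numColumns lam - 1 - (c : ℕ) := by
    rw [funext_iff]
    refine forall_congr' fun c => ?_
    rw [← deltaTop_eq_minus]
    exact hspin _ _
  by_cases hadm : ∀ r c, DeltaAdmissible (x.2 r c.castSucc) (x.1 r.castSucc c) (x.2 r c.succ)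
      (x.1 r.succ c)
  · congr 1
    rw [eq_iff_iff, htop, funext_iff]
    exact ⟨fun h => ⟨h.top, h.left, h.right, h.bottom⟩,
      fun h => ⟨h.2.1, h.2.2.1, h.2.2.2, h.1, hadm⟩⟩
  · rw [if_neg fun h => hadm h.admissible]
    push Not at hadm
    obtain ⟨r, c, h⟩ := hadm
    rw [deltaStateWeight, Finset.prod_eq_zero (Finset.mem_univ r)
      (Finset.prod_eq_zero (Finset.mem_univ c) (deltaWeight_eq_zero _ _ h)), ite_self]

theorem strictAnti_add_rhoWeight {n : ℕ} {lam : Fin n → ℕ} (hlam : Antitone lam) :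
    StrictAnti (lam + rhoWeight n) := fun i j hij => by
  have h1 := hlam hij.le
  have h2 := j.2
  have h3 : (i : ℕ) < j := hij
  simp only [Pi.add_apply, rhoWeight]
  omega

theorem minusLabels_deltaTop {n : ℕ} {lam : Fin n → ℕ} (hlam : Antitone lam) :
    minusLabels (numColumns lam) (deltaTop lam) = List.ofFn (lam + rhoWeight n) := by
  refine (sortedGT_minusLabels _ _).eq_of_mem_iff
    (strictAnti_add_rhoWeight hlam).sortedGT_ofFn fun b => ?_
  simp only [mem_minusLabels, deltaTop_eq_minus, List.mem_ofFn]
  constructor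
  · rintro ⟨c, ⟨i, hi⟩, rfl⟩
    exact ⟨i, hi⟩
  · rintro ⟨i, rfl⟩
    have hn : 0 < n := i.pos
    have h0 : lam i ≤ lam ⟨0, hn⟩ := hlam (Fin.mk_le_of_le_val (Nat.zero_le _))
    have hi : (lam + rhoWeight n) i < numColumns lam := by
      simp only [Pi.add_apply, rhoWeight, numColumns, dif_pos hn]
      omega
    refine ⟨⟨numColumns lam - 1 - (lam + rhoWeight n) i, by omega⟩, ⟨i, ?_⟩, ?_⟩
    · simp only [Pi.add_apply] at hi ⊢
      omega
    · simp only
      omega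

theorem map_aeval_int {S σ : Type*} [CommRing S] (f : R →+* S) (x : σ → R)
    (p : MvPolynomial σ ℤ) : f (MvPolynomial.aeval x p) = MvPolynomial.aeval (f ∘ x) p :=
  MvPolynomial.comp_aeval_apply x f.toIntAlgHom p

theorem aeval_alternant {n : ℕ} (μ : Fin n → ℕ) (z : Fin n → R) :
    MvPolynomial.aeval z (alternant μ) = Matrix.det (Matrix.of fun i j => z i ^ μ j) := by
  rw [alternant, AlgHom.map_det]
  congr 1
  ext i j
  simp

theorem aeval_alternant_rho {n : ℕ} (z : Fin n → R) :
    MvPolynomial.aeval z (alternant (rhoWeight n)) =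
      ∏ i : Fin n, ∏ j ∈ Finset.Ioi i, (z i - z j) := by
  have h := Matrix.det_projVandermonde (fun _ : Fin n => (1 : R)) z
  simp only [one_mul] at h
  rw [aeval_alternant, ← h]
  congr 1
  ext i j
  simp [Matrix.projVandermonde_apply, Fin.val_rev, rhoWeight, Nat.sub_sub, add_comm]

/-- The product formula, multiplied by the Vandermonde determinant `∏_{i < j} (z_i - z_j)`. -/
theorem prod_sub_mul_deltaPartitionFunction {n : ℕ} {lam : Fin n → ℕ} (hlam : Antitone lam)
    (z t : Fin n → R) :
    (∏ i : Fin n, ∏ j ∈ Finset.Ioi i, (z i - z j)) * deltaPartitionFunction lam z t =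
      (∏ i : Fin n, ∏ j ∈ Finset.Ioi i, (z i - z j)) *
        ((∏ i : Fin n, ∏ j ∈ Finset.Ioi i, (t j * z j + z i)) *
          MvPolynomial.aeval z (schurPolynomial lam)) := by
  rw [deltaPartitionFunction_eq_latticeSum, prod_sub_mul_latticeSum, minusLabels_deltaTop hlam,
    wedge_ofFn, topCoeff_ιMulti, mul_left_comm, ← aeval_alternant_rho, ← map_mul,
    alternant_rho_mul_schurPolynomial, aeval_alternant, ← Matrix.det_transpose]
  rfl

end Ensemble

theorem mainTheorem4 {R : Type*} [CommRing R] (n : ℕ) (lam : Fin n → ℕ) (hlam : Antitone lam)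
    (z t : Fin n → R) :
    deltaPartitionFunction lam z t =
      (∏ i : Fin n, ∏ j ∈ Finset.Ioi i, (t j * z j + z i)) *
        MvPolynomial.aeval z (schurPolynomial lam) := by
  -- With independent variables the Vandermonde determinant can be cancelled.
  let Z : Fin n → MvPolynomial (Fin n ⊕ Fin n) ℤ := fun i => MvPolynomial.X (Sum.inl i)
  let T : Fin n → MvPolynomial (Fin n ⊕ Fin n) ℤ := fun i => MvPolynomial.X (Sum.inr i)
  have hne : (∏ i : Fin n, ∏ j ∈ Finset.Ioi i, (Z i - Z j)) ≠ 0 := by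
    refine Finset.prod_ne_zero_iff.2 fun i _ => Finset.prod_ne_zero_iff.2 fun j hj => ?_
    refine sub_ne_zero.2 fun h => (Finset.mem_Ioi.1 hj).ne ?_
    exact Sum.inl_injective (MvPolynomial.X_injective h)
  have h := mul_left_cancel₀ hne (prod_sub_mul_deltaPartitionFunction hlam Z T)
  let f : MvPolynomial (Fin n ⊕ Fin n) ℤ →+* R :=
    (MvPolynomial.aeval (Sum.elim z t)).toRingHom
  have hZ : f ∘ Z = z := by ext i; simp [f, Z]
  have hT : f ∘ T = t := by ext i; simp [f, T]
  have h' := congrArg f h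
  rw [map_mul, map_deltaPartitionFunction, map_aeval_int, hZ, hT] at h'
  rw [h']
  simp only [map_prod, map_add, map_mul, ← hZ, ← hT, Function.comp_apply]
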